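/- Let $P\subset\mathbb{R}^n$ be a polytope, i.e. the convex hull of a finite set of points or a bounded intersection of finitely many closed halfspaces. A linear function $c$ on $\mathbb{R}^n$ is in general position with respect to $P$ if $c(v)\neq c(w)$ for any two distinct vertices $v,w$ of $P$. Such a $c$ orients the graph $G(P)$ of vertices and edges of $P$, an edge $[v,w]$ being directed from $v$ to $w$ if $c(v)>c(w)$; for a face $F$ of $P$, a sink of $F$ is a vertex of $F$ from which no edge of $P$ is directed to another vertex of $F$. A triangulation of a polytope is a finite simplicial complex whose underlying set is the polytope. A triangulation $\mathcal{C}_P$ of $P$ is called a pointed triangulation with apexes $\mathbf{v}_F$ ($F$ a nonempty face of $P$) if, writing $\mathcal{C}_F=\{\sigma\in\mathcal{C}_P : \sigma\subseteq F\}$: 1. for each nonempty face $F$ of $P$, with $k=\dim F$, $\mathcal{C}_F$ is a triangulation of $F$ in which every simplex is a face of a $k$-simplex of $\mathcal{C}_F$, $\mathbf{v}_F$ is a vertex of $F$, and every $k$-simplex of $\mathcal{C}_F$ contains $\mathbf{v}_F$; 2. if $F_1,F_2$ are nonempty faces of $P$ with $\{\mathbf{v}_{F_1},\mathbf{v}_{F_2}\}\subseteq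 F_1\cap F_2$, then $\mathbf{v}_{F_1}=\mathbf{v}_{F_2}$; 3. for each nonempty face $F$ of $P$ and each vertex $w\neq\mathbf{v}_F$ of $F$, the edge $\operatorname{conv}\{\mathbf{v}_F,w\}$ belongs to $\mathcal{C}_F$. **Theorem.** Every polytope $P$ has a pointed triangulation. More precisely, there is a linear function in general position with respect to $P$; and for every such linear function $c$, each nonempty face $F$ of $P$ has exactly one sink in the orientation induced by $c$, and $P$ has a pointed triangulation in which the apex $\mathbf{v}_F$ of every nonempty face $F$ is this sink. -/

import Mathlib

namespace PointedTriangulation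

open Geometry

variable {E : Type*} [NormedAddCommGroup E] [NormedSpace ℝ E]

/-- A V-polytope: the convex hull of a finite set of points (the empty set is allowed). -/
def IsVPolytope (P : Set E) : Prop :=
  ∃ s : Finset E, P = convexHull ℝ (s : Set E)

/-- An H-polytope: a bounded intersection of finitely many closed halfspaces `a i x ≤ z i`. -/
def IsHPolytope (P : Set E) : Prop :=
  Bornology.IsBounded P ∧
    ∃ (m : ℕ) (a : Fin m → StrongDual ℝ E) (z : Fin m → ℝ), P = {x | ∀ i, a i x ≤ z i}

/-- A polytope is a point set that is a V-polytope or an H-polytope. -/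
def IsPolytope (P : Set E) : Prop :=
  IsVPolytope P ∨ IsHPolytope P

/-- `F` is a nonempty face of `P`: the set of maximizers on `P` of some linear function
(`P` itself is a face, through the zero function). -/
def IsNonemptyFace (P F : Set E) : Prop :=
  IsExposed ℝ P F ∧ F.Nonempty

/-- The vertices of `P`: the points `v` such that `{v}` is a face of `P`. -/
def vert (P : Set E) : Set E := P.exposedPoints ℝ

/-- The dimension of a nonempty set: the dimension of its affine hull. -/
noncomputable def dim (S : Set E) : ℕ := Module.finrank ℝ (vectorSpan ℝ S)

/-- The linear function `c` is in general position with respect to `P`: it separates the vertices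
of `P`. -/
def InGeneralPosition (P : Set E) (c : StrongDual ℝ E) : Prop :=
  ∀ v ∈ vert P, ∀ w ∈ vert P, v ≠ w → c v ≠ c w

/-- The graph of `P`: two distinct vertices are adjacent if the segment between them is a face
(an edge) of `P`. -/
def graph (P : Set E) : SimpleGraph E where
  Adj v w := v ≠ w ∧ v ∈ vert P ∧ w ∈ vert P ∧ IsExposed ℝ P (segment ℝ v w)
  symm := ⟨fun v w h => ⟨h.1.symm, h.2.2.1, h.2.1, segment_symm ℝ v w ▸ h.2.2.2⟩⟩

/-- In the orientation of the graph of `P` induced by `c`, an edge is directed from `v` to `w` if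
`c v > c w`. -/
def DirectedEdge (P : Set E) (c : StrongDual ℝ E) (v w : E) : Prop :=
  (graph P).Adj v w ∧ c v > c w

/-- `v` is a sink of the graph of the face `F`, i.e. of the subgraph of the graph of `P` induced on
the vertices of `F`, for the orientation induced by `c`. -/
def IsSink (P : Set E) (c : StrongDual ℝ E) (F : Set E) (v : E) : Prop :=
  v ∈ vert F ∧ ∀ w ∈ vert F, ¬ DirectedEdge P c v w

/-- `K` is a triangulation of `P`: a finite simplicial complex with underlying set `P`. -/
def IsTriangulation (P : Set E) (K : SimplicialComplex ℝ E) : Prop :=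
  K.faces.Finite ∧ K.space = P

/-- The subcomplex of `K` formed by the simplices of `K` that are contained in `F`. -/
def restrict (K : SimplicialComplex ℝ E) (F : Set E) : SimplicialComplex ℝ E where
  faces := {s | s ∈ K.faces ∧ convexHull ℝ (s : Set E) ⊆ F}
  isRelLowerSet_faces := fun _ hs => ⟨K.nonempty_of_mem_faces hs.1, fun _ hts ht =>
    ⟨K.down_closed hs.1 hts ht, (convexHull_mono (Finset.coe_subset.2 hts)).trans hs.2⟩⟩
  indep := fun hs => K.indep hs.1
  inter_subset_convexHull := fun hs ht => K.inter_subset_convexHull hs.1 ht.1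

/-- `K` is a pointed triangulation of `P`, where `apex F` is the apex of the nonempty face `F`
(the values of `apex` on other sets are irrelevant). The triangulation of `F` is the one
that `K` induces on `F`. -/
structure IsPointedTriangulation (P : Set E) (K : SimplicialComplex ℝ E) (apex : Set E → E) :
    Prop where
  triangulation : IsTriangulation P K
  /-- `K` induces a triangulation of each nonempty face. -/
  face_triangulation : ∀ F, IsNonemptyFace P F → IsTriangulation F (restrict K F)
  /-- The triangulation of a `k`-face is generated by its `k`-simplices. -/
  face_pure : ∀ F, IsNonemptyFace P F → ∀ s ∈ (restrict K F).faces,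
    ∃ t ∈ (restrict K F).faces, s ⊆ t ∧ t.card = dim F + 1
  apex_mem_vert : ∀ F, IsNonemptyFace P F → apex F ∈ vert F
  /-- Each `k`-simplex in the triangulation of a `k`-face contains the apex of this face. -/
  apex_mem_simplex : ∀ F, IsNonemptyFace P F → ∀ t ∈ (restrict K F).faces,
    t.card = dim F + 1 → apex F ∈ convexHull ℝ (t : Set E)
  apex_compatible : ∀ F₁ F₂, IsNonemptyFace P F₁ → IsNonemptyFace P F₂ →
    apex F₁ ∈ F₁ ∩ F₂ → apex F₂ ∈ F₁ ∩ F₂ → apex F₁ = apex F₂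
  /-- The edge between the apex and any other vertex of a face is in the triangulation of it. -/
  apex_edge : ∀ F, IsNonemptyFace P F → ∀ w ∈ vert F, w ≠ apex F →
    ∃ e ∈ (restrict K F).faces, (e : Set E) = {apex F, w}

end PointedTriangulation

/-!
Pull the vertices of `P` in increasing order of `c`: every face `F` is triangulated by the cones,
with the vertex `v` of `F` at which `c` is smallest as their apex, over the simplices in the faces
of `F` that avoid `v`. The simplices cover `F` because the ray from `v` through a point of `F`
leaves `F` in a face that avoids `v`; such a face is found with Farkas' lemma. They intersect in
common faces because a point has at most one representation as a convex combination of the vertices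
of a simplex: in two representations of the same point the lowest vertices coincide, since each of
them minimizes `c` on a face that contains both supports, so that part of this vertex can be
subtracted from both. Every simplex lies in one of full dimension because a face that avoids `v`
lies in a facet that avoids `v`.

The minimizer of `c` on a face is its only sink: if `c` is not minimal at the vertex `v`, then it is
negative at some vertex of the vertex figure at `v`, and this gives an edge along which `c`
decreases.
-/

namespace PointedTriangulation

open Geometry
open scoped NNReal

variable {E : Type*} [NormedAddCommGroup E] [NormedSpace ℝ E]

/-! ### Linear inequalities -/

theorem exists_pos_forall_add_mul_neg {ι : Type*} {S : Set ι} (hS : S.Finite) (a b : ι → ℝ)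
    (h : ∀ x ∈ S, a x < 0) : ∃ ε > 0, ∀ x ∈ S, a x + ε * b x < 0 := by
  have eventually_neg : ∀ᶠ ε in nhdsWithin (0 : ℝ) (Set.Ioi 0), ∀ x ∈ S, a x + ε * b x < 0 := by
    refine (Filter.eventually_all_finite hS).2 fun x hx => nhdsWithin_le_nhds ?_
    have hcont : Continuous fun ε : ℝ => a x + ε * b x := by fun_prop
    exact hcont.continuousAt.eventually_lt continuousAt_const (by simpa using h x hx)
  obtain ⟨ε, hneg, hpos⟩ := (eventually_neg.and self_mem_nhdsWithin).exists
  exact ⟨ε, hpos, hneg⟩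

theorem exists_pos_forall_add_mul_nonpos_and_eq_zero {ι : Type*} {S : Set ι} (hS : S.Finite)
    (a b : ι → ℝ) (ha : ∀ x ∈ S, a x ≤ 0) (hab : ∀ x ∈ S, 0 < b x → a x < 0)
    (hb : ∃ x ∈ S, 0 < b x) :
    ∃ ε > 0, (∀ x ∈ S, a x + ε * b x ≤ 0) ∧ ∃ x ∈ S, 0 < b x ∧ a x + ε * b x = 0 := by
  obtain ⟨w, ⟨hwS, hw⟩, hmin⟩ := Set.exists_min_image {x ∈ S | 0 < b x} (fun x => -a x / b x)
    (hS.subset (Set.sep_subset _ _)) hb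
  have hε : 0 < -a w / b w := div_pos (neg_pos.2 (hab w hwS hw)) hw
  refine ⟨-a w / b w, hε, fun x hx => ?_, w, hwS, hw, ?_⟩
  · rcases lt_or_ge 0 (b x) with h | h
    · linarith [(le_div_iff₀ h).1 (hmin x ⟨hx, h⟩)]
    · linarith [ha x hx, mul_nonpos_of_nonneg_of_nonpos hε.le h]
  · rw [div_mul_cancel₀ _ hw.ne', add_neg_cancel]

theorem forall_mem_hull_nonpos {S : Set E} {l : StrongDual ℝ E} (h : ∀ x ∈ S, l x ≤ 0) :
    ∀ x ∈ PointedCone.hull ℝ S, l x ≤ 0 := fun x hx => by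
  induction hx using Submodule.span_induction with
  | mem x hx => exact h x hx
  | zero => rw [map_zero]
  | add x y _ _ hx hy => rw [map_add]; exact add_nonpos hx hy
  | smul r x _ hx => exact (map_smul l r.1 x).trans_le (smul_nonpos_of_nonneg_of_nonpos r.2 hx)

/-- The projection along `v` onto the kernel of `k` moves the points of the cone over `S` in the
direction of `v`, and it moves `g` in the opposite direction. -/
theorem mem_hull_insert_of_sub_smul_mem {S : Set E} {k : StrongDual ℝ E} {v g : E}
    (hk : ∀ x ∈ S, k x ≤ 0) (hkg : 0 ≤ k g)
    (h : g - k g • v ∈ PointedCone.hull ℝ ((fun x => x - k x • v) '' S)) :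
    g ∈ PointedCone.hull ℝ (insert v S) := by
  let π : E →ₗ[ℝ] E := LinearMap.id - k.toLinearMap.smulRight v
  obtain ⟨y, hy, hyg⟩ : g - k g • v ∈ (PointedCone.hull ℝ S).map π := by
    rw [PointedCone.map, PointedCone.hull, Submodule.map_span]
    exact h
  have hg : g = y + (k g - k y) • v := by
    have hyg : y - k y • v = g - k g • v := hyg
    rw [sub_smul, add_sub_left_comm, hyg, add_sub_cancel]
  rw [hg]
  refine add_mem (Submodule.span_mono (Set.subset_insert v S) hy) (PointedCone.smul_mem _ ?_
    (PointedCone.subset_hull (Set.mem_insert v S)))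
  linarith [forall_mem_hull_nonpos hk y hy]

/-- **Farkas' lemma** for finitely generated cones. -/
theorem mem_hull_image_of_forall_strongDual_nonpos {ι : Type*} {S : Set ι} (hS : S.Finite)
    (a : ι → E) (g : E) (h : ∀ l : StrongDual ℝ E, (∀ i ∈ S, l (a i) ≤ 0) → l g ≤ 0) :
    g ∈ PointedCone.hull ℝ (a '' S) := by
  induction S, hS using Set.Finite.induction_on generalizing a g with
  | empty =>
    have hg : g = 0 := SeparatingDual.eq_zero_of_forall_dual_eq_zero (R := ℝ) fun l =>
      (h l (by simp)).antisymm (by simpa using h (-l) (by simp))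
    exact hg ▸ zero_mem _
  | @insert j S _ _ ih =>
    rw [Set.image_insert_eq]
    by_cases hS : ∀ l : StrongDual ℝ E, (∀ i ∈ S, l (a i) ≤ 0) → l g ≤ 0
    · exact Submodule.span_mono (Set.subset_insert _ _) (ih a g hS)
    obtain ⟨l, hlS, hlg⟩ : ∃ l : StrongDual ℝ E, (∀ i ∈ S, l (a i) ≤ 0) ∧ 0 < l g := by
      simpa using hS
    have hlj : 0 < l (a j) := by
      by_contra! hlj
      exact hlg.not_ge (h l (Set.forall_mem_insert.2 ⟨hlj, hlS⟩))
    let k : StrongDual ℝ E := (l (a j))⁻¹ • l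
    have hkj : k (a j) = 1 := inv_mul_cancel₀ hlj.ne'
    have hkS : ∀ x ∈ a '' S, k x ≤ 0 := Set.forall_mem_image.2 fun i hi =>
      mul_nonpos_of_nonneg_of_nonpos (inv_pos.2 hlj).le (hlS i hi)
    refine mem_hull_insert_of_sub_smul_mem hkS
      (mul_pos (inv_pos.2 hlj) hlg).le ?_
    rw [Set.image_image]
    refine ih (fun i => a i - k (a i) • a j) _ fun m hm => ?_
    have hmk : ∀ x, (m - m (a j) • k) x = m (x - k x • a j) := fun x => by
      simp [mul_comm]
    rw [← hmk]
    refine h _ (Set.forall_mem_insert.2 ⟨by simp [hkj], fun i hi => ?_⟩)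
    rw [hmk]
    exact hm i hi

/-! ### Conic combinations -/

/-- The conic combination, with weights `a`, of the points of `V` placed at height one in `ℝ × V`.
It is the point `(1, p)` exactly if `a` represents `p` as a convex combination, and working in the
cone allows the removal of a point from a combination without renormalizing the weights. -/
noncomputable def conicCombination (V : Type*) [AddCommGroup V] [Module ℝ V] :
    (V →₀ ℝ≥0) →ₗ[ℝ≥0] ℝ × V :=
  Finsupp.linearCombination ℝ≥0 fun x => (1, x)

section ConicCombination

variable {V : Type*} [AddCommGroup V] [Module ℝ V]

theorem conicCombination_single (x : V) (r : ℝ≥0) :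
    conicCombination V (Finsupp.single x r) = r • ((1 : ℝ), x) :=
  Finsupp.linearCombination_single ..

theorem map_conicCombination {W : Type*} [AddCommGroup W] [Module ℝ W] (f : ℝ × V →ₗ[ℝ] W)
    (a : V →₀ ℝ≥0) : f (conicCombination V a) = ∑ x ∈ a.support, (a x : ℝ) • f (1, x) := by
  rw [conicCombination, Finsupp.linearCombination_apply, Finsupp.sum, map_sum]
  exact Finset.sum_congr rfl fun x _ => map_smul f (a x : ℝ) (1, x)

theorem eq_zero_of_conicCombination_eq_zero {a : V →₀ ℝ≥0} (h : conicCombination V a = 0) :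
    a = 0 := by
  have hsum : ∑ x ∈ a.support, (a x : ℝ) = 0 := by
    simpa [h] using (map_conicCombination (LinearMap.fst ℝ ℝ V) a).symm
  have hzero := (Finset.sum_eq_zero_iff_of_nonneg fun x _ => (a x).2).1 hsum
  exact Finsupp.support_eq_empty.1 (Finset.eq_empty_of_forall_notMem fun x hx =>
    Finsupp.mem_support_iff.1 hx (NNReal.coe_eq_zero.1 (hzero x hx)))

theorem mem_convexHull_iff_exists_conicCombination {S : Set V} {p : V} :
    p ∈ convexHull ℝ S ↔
      ∃ a : V →₀ ℝ≥0, (a.support : Set V) ⊆ S ∧ conicCombination V a = (1, p) := by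
  classical
  constructor
  · intro hp
    obtain ⟨ι, _, w, z, hw, hw1, hz, rfl⟩ := mem_convexHull_iff_exists_fintype.1 hp
    lift w to ι → ℝ≥0 using hw
    refine ⟨∑ i, Finsupp.single (z i) (w i), fun x hx => ?_, ?_⟩
    · obtain ⟨i, -, hi⟩ := Finset.mem_biUnion.1 (Finsupp.support_finsetSum hx)
      rw [Finset.mem_singleton.1 (Finsupp.support_single_subset hi)]
      exact hz i
    · simp only [map_sum, conicCombination_single]
      ext <;> simp [Prod.fst_sum, Prod.snd_sum, NNReal.smul_def, hw1]
  · rintro ⟨a, haS, ha⟩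
    refine convexHull_mono haS (Finset.mem_convexHull'.2 ⟨fun x => a x, fun x _ => (a x).2, ?_, ?_⟩)
    · simpa [ha] using (map_conicCombination (LinearMap.fst ℝ ℝ V) a).symm
    · simpa [ha] using (map_conicCombination (LinearMap.snd ℝ ℝ V) a).symm

end ConicCombination

/-! ### Exposed faces -/

theorem isExposed_setOf_eq {P : Set E} {l : StrongDual ℝ E} {M : ℝ} (h : ∀ x ∈ P, l x ≤ M) :
    IsExposed ℝ P {x ∈ P | l x = M} := by
  rintro ⟨w, hw, rfl⟩
  exact ⟨l, Set.ext fun x => and_congr_right fun hx =>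
    ⟨fun hxw y hy => (h y hy).trans_eq hxw.symm, fun hmax => (h x hx).antisymm (hmax w hw)⟩⟩

theorem exists_eq_setOf_of_isExposed {P F : Set E} (hF : IsExposed ℝ P F) (hne : F.Nonempty) :
    ∃ (l : StrongDual ℝ E) (M : ℝ), (∀ x ∈ P, l x ≤ M) ∧ F = {x ∈ P | l x = M} := by
  obtain ⟨l, rfl⟩ := hF hne
  obtain ⟨w, hw, hmax⟩ := hne
  exact ⟨l, l w, hmax, Set.ext fun x => and_congr_right fun hx =>
    ⟨fun hx' => (hmax x hx).antisymm (hx' w hw), fun hxw y hy => (hmax y hy).trans_eq hxw.symm⟩⟩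

theorem support_subset_of_isExposed {P F : Set E} (hF : IsExposed ℝ P F) {a b : E →₀ ℝ≥0}
    (haP : (a.support : Set E) ⊆ P) (hbF : (b.support : Set E) ⊆ F)
    (hab : conicCombination E a = conicCombination E b) : (a.support : Set E) ⊆ F := by
  rcases F.eq_empty_or_nonempty with rfl | hne
  · obtain rfl : b = 0 := by simpa using hbF
    rw [eq_zero_of_conicCombination_eq_zero (hab.trans (map_zero _))]
    simp
  obtain ⟨l, M, hl, rfl⟩ := exists_eq_setOf_of_isExposed hF hne
  let slack : ℝ × E →ₗ[ℝ] ℝ := M • LinearMap.fst ℝ ℝ E - l.toLinearMap ∘ₗ LinearMap.snd ℝ ℝ E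
  have slack_apply : ∀ x, slack (1, x) = M - l x := fun x => by simp [slack]
  have hsum : ∑ x ∈ a.support, (a x : ℝ) * (M - l x) = 0 := by
    calc ∑ x ∈ a.support, (a x : ℝ) * (M - l x)
      _ = ∑ x ∈ b.support, (b x : ℝ) * (M - l x) := by
        simpa only [map_conicCombination, slack_apply, smul_eq_mul] using congrArg slack hab
      _ = 0 := Finset.sum_eq_zero fun x hx => by rw [(hbF hx).2, sub_self, mul_zero]
  have hzero := (Finset.sum_eq_zero_iff_of_nonneg fun x hx =>
    mul_nonneg (a x).2 (sub_nonneg.2 (hl x (haP hx)))).1 hsum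
  refine fun x hx => ⟨haP hx, ?_⟩
  have hax : (a x : ℝ) ≠ 0 := NNReal.coe_ne_zero.2 (Finsupp.mem_support_iff.1 hx)
  exact (sub_eq_zero.1 ((mul_eq_zero.1 (hzero x hx)).resolve_left hax)).symm

theorem eq_convexHull_inter_of_isExposed {S F : Set E} (hF : IsExposed ℝ (convexHull ℝ S) F) :
    F = convexHull ℝ (S ∩ F) := by
  refine Set.Subset.antisymm (fun p hp => ?_)
    (convexHull_min Set.inter_subset_right (hF.convex (convex_convexHull ℝ S)))
  obtain ⟨a, haS, ha⟩ := mem_convexHull_iff_exists_conicCombination.1 (hF.subset hp)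
  have haF : (a.support : Set E) ⊆ F :=
    support_subset_of_isExposed hF (b := Finsupp.single p 1)
      (haS.trans (subset_convexHull ℝ S)) (by simpa using hp)
      (by rw [ha, conicCombination_single, one_smul])
  exact mem_convexHull_iff_exists_conicCombination.2 ⟨a, Set.subset_inter haS haF, ha⟩

theorem le_of_mem_convexHull {S : Set E} {l : StrongDual ℝ E} {M : ℝ} (h : ∀ x ∈ S, l x ≤ M) :
    ∀ x ∈ convexHull ℝ S, l x ≤ M :=
  fun _ hx => convexHull_min (t := {x | l x ≤ M}) h (convex_halfSpace_le l.isLinear M) hx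

theorem isExposed_convexHull_setOf_eq {S : Set E} {l : StrongDual ℝ E} {M : ℝ}
    (h : ∀ x ∈ S, l x ≤ M) : IsExposed ℝ (convexHull ℝ S) (convexHull ℝ {x ∈ S | l x = M}) := by
  have hF := isExposed_setOf_eq (le_of_mem_convexHull h)
  have hinter : S ∩ {x ∈ convexHull ℝ S | l x = M} = {x ∈ S | l x = M} :=
    Set.ext fun x => and_congr_right fun hx => and_iff_right (subset_convexHull ℝ S hx)
  rw [← hinter, ← eq_convexHull_inter_of_isExposed hF]
  exact hF

/-! ### Faces and vertices of polytopes -/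

theorem vert_subset (P : Set E) : vert P ⊆ P := exposedPoints_subset

theorem vert_convexHull_subset (S : Set E) : vert (convexHull ℝ S) ⊆ S :=
  exposedPoints_subset_extremePoints.trans extremePoints_convexHull_subset

namespace IsVPolytope

variable {P F G : Set E}

theorem isCompact (hP : IsVPolytope P) : IsCompact P := by
  obtain ⟨S, rfl⟩ := hP
  exact S.finite_toSet.isCompact_convexHull ℝ

theorem convex (hP : IsVPolytope P) : Convex ℝ P := by
  obtain ⟨S, rfl⟩ := hP
  exact convex_convexHull ℝ _

theorem finite_vert (hP : IsVPolytope P) : (vert P).Finite := by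
  obtain ⟨S, rfl⟩ := hP
  exact S.finite_toSet.subset (vert_convexHull_subset _)

theorem extremePoints_subset_vert (hP : IsVPolytope P) : P.extremePoints ℝ ⊆ vert P := by
  obtain ⟨S, rfl⟩ := hP
  intro x hx
  have hxS : x ∉ convexHull ℝ ((S : Set E) \ {x}) := fun h =>
    ((convex_convexHull ℝ _).mem_extremePoints_iff_mem_sdiff_convexHull_sdiff.1 hx).2
      (convexHull_mono (Set.sdiff_subset_sdiff_left (subset_convexHull ℝ _)) h)
  obtain ⟨l, u, hlu, hux⟩ := geometric_hahn_banach_closed_point (convex_convexHull ℝ _)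
    (S.finite_toSet.sdiff.isClosed_convexHull ℝ) hxS
  have hlt : ∀ y ∈ (S : Set E), y ≠ x → l y < l x := fun y hy hyx =>
    (hlu y (subset_convexHull ℝ _ ⟨hy, hyx⟩)).trans hux
  have hface : {y ∈ (S : Set E) | l y = l x} = {x} :=
    Set.ext fun y => ⟨fun hy => of_not_not fun hyx => (hlt y hy.1 hyx).ne hy.2,
      fun hyx => ⟨hyx ▸ extremePoints_convexHull_subset hx, congrArg l hyx⟩⟩
  have hexp := isExposed_convexHull_setOf_eq (S := (S : Set E)) (l := l) (M := l x) fun y hy =>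
    (eq_or_ne y x).elim (fun hyx => hyx ▸ le_rfl) fun hyx => (hlt y hy hyx).le
  rw [hface, convexHull_singleton] at hexp
  exact mem_exposedPoints_iff_exposed_singleton.2 hexp

theorem convexHull_vert (hP : IsVPolytope P) : convexHull ℝ (vert P) = P := by
  refine Set.Subset.antisymm (convexHull_min (vert_subset P) hP.convex) ?_
  calc P = closure (convexHull ℝ (P.extremePoints ℝ)) :=
        (closure_convexHull_extremePoints hP.isCompact hP.convex).symm
    _ ⊆ convexHull ℝ (vert P) := closure_minimal (convexHull_mono hP.extremePoints_subset_vert)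
        (hP.finite_vert.isClosed_convexHull ℝ)

theorem le_of_forall_vert (hP : IsVPolytope P) {l : StrongDual ℝ E} {M : ℝ}
    (h : ∀ x ∈ vert P, l x ≤ M) : ∀ x ∈ P, l x ≤ M :=
  hP.convexHull_vert ▸ le_of_mem_convexHull h

theorem isExposed_convexHull_setOf_eq (hP : IsVPolytope P) {l : StrongDual ℝ E} {M : ℝ}
    (h : ∀ x ∈ vert P, l x ≤ M) : IsExposed ℝ P (convexHull ℝ {x ∈ vert P | l x = M}) := by
  simpa only [hP.convexHull_vert] using PointedTriangulation.isExposed_convexHull_setOf_eq h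

theorem convexHull_vert_inter (hP : IsVPolytope P) (hF : IsExposed ℝ P F) :
    convexHull ℝ (vert P ∩ F) = F :=
  (eq_convexHull_inter_of_isExposed (by rwa [hP.convexHull_vert])).symm

theorem isExposed (hP : IsVPolytope P) (hF : IsExposed ℝ P F) : IsVPolytope F :=
  ⟨(hP.finite_vert.inter_of_left F).toFinset, by
    rw [Set.Finite.coe_toFinset, hP.convexHull_vert_inter hF]⟩

theorem isExposed_trans (hP : IsVPolytope P) (hF : IsExposed ℝ P F) (hG : IsExposed ℝ F G) :
    IsExposed ℝ P G := by
  rcases G.eq_empty_or_nonempty with rfl | hne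
  · exact isExposed_empty
  obtain ⟨m, μ, hm, hGm⟩ := exists_eq_setOf_of_isExposed hG hne
  obtain ⟨l, M, hl, hFl⟩ := exists_eq_setOf_of_isExposed hF (hne.mono hG.subset)
  have hF_eq : ∀ x ∈ F, l x = M := fun x hx => (hFl ▸ hx).2
  have hF_lt : ∀ x ∈ vert P, x ∉ F → l x < M := fun x hx hxF =>
    (hl x (vert_subset P hx)).lt_of_ne fun h => hxF (hFl ▸ ⟨vert_subset P hx, h⟩)
  obtain ⟨ε, hε, hneg⟩ := exists_pos_forall_add_mul_neg (S := vert P \ F) hP.finite_vert.sdiff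
    (fun x => l x - M) (fun x => m x - μ) fun x hx => sub_neg.2 (hF_lt x hx.1 hx.2)
  have apply_eq : ∀ x, (l + ε • m) x - (M + ε * μ) = (l x - M) + ε * (m x - μ) := fun x => by
    simp only [add_apply, smul_apply, smul_eq_mul]
    ring
  have hle : ∀ x ∈ vert P, (l + ε • m) x ≤ M + ε * μ := fun x hx => by
    rw [← sub_nonpos, apply_eq]
    by_cases hxF : x ∈ F
    · rw [hF_eq x hxF, sub_self, zero_add]
      exact mul_nonpos_of_nonneg_of_nonpos hε.le (sub_nonpos.2 (hm x hxF))
    · exact (hneg x ⟨hx, hxF⟩).le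
  have hface : {x ∈ vert P | (l + ε • m) x = M + ε * μ} = vert P ∩ F ∩ G := by
    ext x
    rw [Set.mem_sep_iff, Set.inter_assoc, ← sub_eq_zero, apply_eq]
    refine and_congr_right fun hx => ⟨fun h => ?_, fun ⟨hxF, hxG⟩ => ?_⟩
    · have hxF : x ∈ F := of_not_not fun hxF => (hneg x ⟨hx, hxF⟩).ne h
      rw [hF_eq x hxF, sub_self, zero_add] at h
      exact ⟨hxF, hGm ▸ ⟨hxF, sub_eq_zero.1 ((mul_eq_zero.1 h).resolve_left hε.ne')⟩⟩
    · rw [hF_eq x hxF, (hGm ▸ hxG : x ∈ {x ∈ F | m x = μ}).2, sub_self, sub_self, mul_zero,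
        add_zero]
  have hexp := hP.isExposed_convexHull_setOf_eq hle
  rw [← hP.convexHull_vert_inter hF] at hG
  rwa [hface, ← eq_convexHull_inter_of_isExposed hG] at hexp

theorem vert_face (hP : IsVPolytope P) (hF : IsExposed ℝ P F) : vert F = vert P ∩ F := by
  ext x
  simp only [vert, Set.mem_inter_iff, mem_exposedPoints_iff_exposed_singleton]
  exact ⟨fun h => ⟨hP.isExposed_trans hF h, h.subset rfl⟩,
    fun h => h.1.mono hF.subset (Set.singleton_subset_iff.2 h.2)⟩

theorem ncard_vert_lt (hP : IsVPolytope P) (hF : IsExposed ℝ P F) (hne : F ≠ P) :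
    (vert F).ncard < (vert P).ncard := by
  refine Set.ncard_lt_ncard ?_ hP.finite_vert
  rw [hP.vert_face hF]
  refine Set.inter_subset_left.ssubset_of_ne fun h => hne ?_
  rw [← hP.convexHull_vert_inter hF, h, hP.convexHull_vert]

theorem exists_isMinOn_vert (hP : IsVPolytope P) (hne : P.Nonempty) (c : StrongDual ℝ E) :
    ∃ v ∈ vert P, IsMinOn c P v := by
  have hvert : (vert P).Nonempty := by rwa [← convexHull_nonempty_iff (𝕜 := ℝ), hP.convexHull_vert]
  obtain ⟨v, hv, hmin⟩ := Set.exists_min_image (vert P) c hP.finite_vert hvert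
  exact ⟨v, hv, fun x hx => neg_le_neg_iff.1
    (hP.le_of_forall_vert (l := -c) (M := -c v) (fun y hy => neg_le_neg (hmin y hy)) x hx)⟩

end IsVPolytope

/-! ### Edges at a vertex -/

theorem eq_of_sameRay_sub_of_mem_extremePoints {V : Type*} [AddCommGroup V] [Module ℝ V]
    {P : Set V} {v x y : V} (hv : v ∈ P) (hx : x ∈ P.extremePoints ℝ)
    (hy : y ∈ P.extremePoints ℝ) (hxv : x ≠ v) (hyv : y ≠ v) (h : SameRay ℝ (x - v) (y - v)) :
    x = y := by
  rw [mem_extremePoints_iff_forall_segment] at hx hy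
  rcases wbtw_total_of_sameRay_vsub_left (x := v) (y := x) (z := y) h with hxy | hyx
  · exact ((hx.2 v hv y hy.1 (mem_segment_iff_wbtw.2 hxy)).resolve_left hxv.symm).symm
  · exact (hy.2 v hv x hx.1 (mem_segment_iff_wbtw.2 hyx)).resolve_left hyv.symm

theorem exists_strongDual_lt_of_mem_vert {P : Set E} {v : E} (hv : v ∈ vert P) :
    ∃ l : StrongDual ℝ E, ∀ x ∈ P, x ≠ v → l x < l v := by
  obtain ⟨-, l, hl⟩ := hv
  exact ⟨l, fun x hx hxv => (hl x hx).1.lt_of_ne fun h => hxv ((hl x hx).2 h.ge)⟩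

/-- The direction from `v` to `x`, scaled to the hyperplane `l = -1`. If `l` exposes the vertex `v`
of a polytope, then the directions towards its other vertices span the vertex figure at `v`, whose
vertices correspond to the edges at `v`. -/
noncomputable def vertexFigureMap (l : StrongDual ℝ E) (v x : E) : E :=
  (l v - l x)⁻¹ • (x - v)

theorem smul_vertexFigureMap {l : StrongDual ℝ E} {v x : E} (h : l x < l v) :
    (l v - l x) • vertexFigureMap l v x = x - v :=
  smul_inv_smul₀ (sub_pos.2 h).ne' _

theorem apply_vertexFigureMap {l : StrongDual ℝ E} {v x : E} (h : l x < l v) :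
    l (vertexFigureMap l v x) = -1 := by
  rw [vertexFigureMap, map_smul, map_sub, smul_eq_mul, ← neg_sub (l v), mul_neg,
    inv_mul_cancel₀ (sub_pos.2 h).ne']

theorem apply_sub_eq_mul_apply_vertexFigureMap {l : StrongDual ℝ E} {v x : E} (h : l x < l v)
    (m : StrongDual ℝ E) : m x - m v = (l v - l x) * m (vertexFigureMap l v x) := by
  rw [← map_sub, ← smul_vertexFigureMap h, map_smul, smul_eq_mul]

theorem add_smul_apply_sub_eq_mul {l : StrongDual ℝ E} {v x : E} (h : l x < l v)
    (m : StrongDual ℝ E) (r : ℝ) :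
    (m + r • l) x - (m + r • l) v = (l v - l x) * (m (vertexFigureMap l v x) - r) := by
  rw [apply_sub_eq_mul_apply_vertexFigureMap h, add_apply, smul_apply, apply_vertexFigureMap h,
    smul_eq_mul, mul_neg_one, ← sub_eq_add_neg]

theorem sameRay_sub_of_vertexFigureMap_eq {l : StrongDual ℝ E} {v x y : E} (hx : l x < l v)
    (hy : l y < l v) (h : vertexFigureMap l v x = vertexFigureMap l v y) :
    SameRay ℝ (x - v) (y - v) := by
  rw [← smul_vertexFigureMap hx, ← smul_vertexFigureMap hy, h]
  exact (SameRay.sameRay_nonneg_smul_left _ (sub_pos.2 hx).le).nonneg_smul_right (sub_pos.2 hy).le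

namespace IsVPolytope

variable {P : Set E} {l : StrongDual ℝ E} {v : E}

theorem isExposed_segment_of_mem_vert_vertexFigure (hP : IsVPolytope P) (hv : v ∈ vert P)
    (hl : ∀ x ∈ vert P \ {v}, l x < l v) {y : E} (hy : y ∈ vert P \ {v})
    (hd : vertexFigureMap l v y ∈
      vert (convexHull ℝ (vertexFigureMap l v '' (vert P \ {v})))) :
    IsExposed ℝ P (segment ℝ v y) := by
  obtain ⟨m, hm⟩ := exists_strongDual_lt_of_mem_vert hd
  set d := vertexFigureMap l v y
  -- On the hyperplane `l = -1` this functional is `m - m d`.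
  let φ : StrongDual ℝ E := m + m d • l
  have hneg : ∀ x ∈ vert P \ {v}, x ≠ y → φ x < φ v := fun x hx hxy => by
    rw [← sub_neg, add_smul_apply_sub_eq_mul (hl x hx)]
    refine mul_neg_of_pos_of_neg (sub_pos.2 (hl x hx)) (sub_neg.2 (hm _
      (subset_convexHull ℝ _ (Set.mem_image_of_mem _ hx)) fun hxd => hxy ?_))
    exact eq_of_sameRay_sub_of_mem_extremePoints (vert_subset P hv)
      (exposedPoints_subset_extremePoints hx.1) (exposedPoints_subset_extremePoints hy.1)
      hx.2 hy.2 (sameRay_sub_of_vertexFigureMap_eq (hl x hx) (hl y hy) hxd)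
  have hφy : φ y = φ v := by
    rw [← sub_eq_zero, add_smul_apply_sub_eq_mul (hl y hy), sub_self, mul_zero]
  have hface : {x ∈ vert P | φ x = φ v} = {v, y} := by
    ext x
    refine ⟨fun hx => ?_, ?_⟩
    · by_contra hxvy
      obtain ⟨hxv, hxy⟩ := not_or.1 hxvy
      exact (hneg x ⟨hx.1, hxv⟩ hxy).ne hx.2
    · rintro (rfl | rfl)
      exacts [⟨hv, rfl⟩, ⟨hy.1, hφy⟩]
  have hexp := hP.isExposed_convexHull_setOf_eq (l := φ) (M := φ v) fun x hx => by
    by_cases hxv : x = v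
    · rw [hxv]
    by_cases hxy : x = y
    · rw [hxy, hφy]
    exact (hneg x ⟨hx, hxv⟩ hxy).le
  rwa [hface, convexHull_pair] at hexp

theorem exists_isExposed_segment_lt (hP : IsVPolytope P) {c : StrongDual ℝ E} (hv : v ∈ vert P)
    (hmin : ¬IsMinOn c P v) : ∃ w ∈ vert P, c w < c v ∧ IsExposed ℝ P (segment ℝ v w) := by
  obtain ⟨l, hl⟩ := exists_strongDual_lt_of_mem_vert hv
  have hl_vert : ∀ x ∈ vert P \ {v}, l x < l v := fun x hx => hl x (vert_subset P hx.1) hx.2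
  have hfig : IsVPolytope (convexHull ℝ (vertexFigureMap l v '' (vert P \ {v}))) :=
    ⟨(hP.finite_vert.sdiff.image _).toFinset, by rw [Set.Finite.coe_toFinset]⟩
  obtain ⟨u, hu, hminu⟩ := hP.exists_isMinOn_vert ⟨v, vert_subset P hv⟩ c
  have huv : c u < c v := lt_of_not_ge fun hvu => hmin fun x hx => hvu.trans (hminu hx)
  have hu' : u ∈ vert P \ {v} := ⟨hu, fun h => huv.ne (congrArg c h)⟩
  have hu_mem := subset_convexHull ℝ _ (Set.mem_image_of_mem (vertexFigureMap l v) hu')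
  obtain ⟨d, hd, hmind⟩ := hfig.exists_isMinOn_vert ⟨_, hu_mem⟩ c
  obtain ⟨y, hy, rfl⟩ := vert_convexHull_subset _ hd
  have apply_neg_iff : ∀ x ∈ vert P \ {v}, c (vertexFigureMap l v x) < 0 ↔ c x < c v :=
    fun x hx => by
      rw [← sub_neg (a := c x), apply_sub_eq_mul_apply_vertexFigureMap (hl_vert x hx),
        ← smul_eq_mul, smul_neg_iff_of_pos_left (sub_pos.2 (hl_vert x hx))]
  exact ⟨y, hy.1, (apply_neg_iff y hy).1 ((hmind hu_mem).trans_lt ((apply_neg_iff u hu').2 huv)),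
    hP.isExposed_segment_of_mem_vert_vertexFigure hv hl_vert hy hd⟩

end IsVPolytope

/-! ### Faces and facets avoiding a point -/

theorem exists_last_mem_on_ray {P : Set E} (hP : IsCompact P) {v p : E} (hp : p ∈ P)
    (hpv : p ≠ v) : ∃ q ∈ P, p ∈ segment ℝ v q ∧ ∀ r > (0 : ℝ), q + r • (q - v) ∉ P := by
  have hpv' : p - v ≠ 0 := sub_ne_zero.2 hpv
  have hcompact : IsCompact {t : ℝ | v + t • (p - v) ∈ P} :=
    ((Homeomorph.addLeft v).isClosedEmbedding.comp
      (isClosedEmbedding_smul_left hpv')).isCompact_preimage hP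
  have hone : (1 : ℝ) ∈ {t : ℝ | v + t • (p - v) ∈ P} := by simpa using hp
  obtain ⟨t, ht, hmax⟩ := hcompact.exists_isGreatest ⟨1, hone⟩
  have ht1 : 1 ≤ t := hmax hone
  have ht0 : 0 < t := one_pos.trans_le ht1
  refine ⟨v + t • (p - v), ht, ?_, fun r hr hmem => ?_⟩
  · rw [segment_eq_image']
    exact ⟨t⁻¹, ⟨(inv_pos.2 ht0).le, inv_le_one_of_one_le₀ ht1⟩, by simp [ht0.ne']⟩
  · have hmem' : v + (t + r * t) • (p - v) ∈ P := by
      convert hmem using 1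
      module
    linarith [hmax hmem', mul_pos hr ht0]

namespace IsVPolytope

variable {P F G : Set E} {v p q : E}

theorem exists_strongDual_le_and_lt (hP : IsVPolytope P) (hq : q ∈ P)
    (hlast : ∀ r > (0 : ℝ), q + r • (q - v) ∉ P) :
    ∃ l : StrongDual ℝ E, (∀ x ∈ P, l x ≤ l q) ∧ l v < l q := by
  by_contra! hsep
  have hfarkas : q - v ∈ PointedCone.hull ℝ ((fun x => x - q) '' vert P) := by
    refine mem_hull_image_of_forall_strongDual_nonpos hP.finite_vert _ _ fun l hl => ?_
    rw [map_sub, sub_nonpos]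
    exact hsep l (hP.le_of_forall_vert fun x hx => by simpa using hl x hx)
  have hconv : Convex ℝ ((fun x => x - q) '' P) := by
    simpa [sub_eq_neg_add] using hP.convex.translate (-q)
  have hzero : (0 : E) ∈ (fun x => x - q) '' P := ⟨q, hq, sub_self q⟩
  have hle : PointedCone.hull ℝ ((fun x => x - q) '' vert P) ≤
      (ConvexCone.hull ℝ _).toPointedCone (ConvexCone.subset_hull hzero) :=
    Submodule.span_le.2 ((Set.image_mono (vert_subset P)).trans ConvexCone.subset_hull)
  obtain ⟨r, hr, _, ⟨x, hx, rfl⟩, hxq⟩ :=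
    (ConvexCone.mem_hull_of_convex hconv).1 (hle hfarkas)
  refine hlast r⁻¹ (inv_pos.2 hr) ?_
  rwa [← hxq, inv_smul_smul₀ hr.ne', add_sub_cancel]

theorem exists_isExposed_notMem_and_mem_segment (hP : IsVPolytope P) (hp : p ∈ P) (hpv : p ≠ v) :
    ∃ F, IsExposed ℝ P F ∧ v ∉ F ∧ ∃ q ∈ F, p ∈ segment ℝ v q := by
  obtain ⟨q, hq, hpq, hlast⟩ := exists_last_mem_on_ray hP.isCompact hp hpv
  obtain ⟨l, hl, hlv⟩ := hP.exists_strongDual_le_and_lt hq hlast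
  exact ⟨_, isExposed_setOf_eq hl, fun hv => hlv.ne hv.2, q, ⟨hq, rfl⟩, hpq⟩

theorem finiteDimensional_vectorSpan (hP : IsVPolytope P) :
    FiniteDimensional ℝ (vectorSpan ℝ P) := by
  obtain ⟨S, rfl⟩ := hP
  rw [← direction_affineSpan, affineSpan_convexHull, direction_affineSpan]
  exact finiteDimensional_vectorSpan_of_finite ℝ S.finite_toSet

end IsVPolytope

theorem vectorSpan_le_ker_of_forall_eq {S : Set E} {l : StrongDual ℝ E} {M : ℝ}
    (h : ∀ x ∈ S, l x = M) : vectorSpan ℝ S ≤ l.ker := by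
  rw [vectorSpan, Submodule.span_le]
  rintro _ ⟨x, hx, y, hy, rfl⟩
  simp [h x hx, h y hy]

theorem dim_lt_of_isExposed {P F : Set E} [FiniteDimensional ℝ (vectorSpan ℝ P)]
    (hF : IsExposed ℝ P F) (hne : F.Nonempty) (hFP : F ≠ P) : dim F < dim P := by
  refine Submodule.finrank_lt_finrank_of_lt
    ((vectorSpan_mono ℝ hF.subset).lt_of_ne fun hspan => hFP ?_)
  obtain ⟨l, M, -, rfl⟩ := exists_eq_setOf_of_isExposed hF hne
  obtain ⟨w, hw, hwM⟩ := hne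
  refine Set.Subset.antisymm (Set.sep_subset _ _) fun x hx => ⟨hx, ?_⟩
  have hmem := vectorSpan_le_ker_of_forall_eq (fun x hx => hx.2)
    (hspan ▸ vsub_mem_vectorSpan ℝ hx hw)
  rw [← hwM, ← sub_eq_zero, ← map_sub]
  exact hmem

theorem exists_strongDual_le_ker_and_pos (W : Submodule ℝ E) [IsClosed (W : Set E)] {x : E}
    (hx : x ∉ W) : ∃ m : StrongDual ℝ E, W ≤ m.ker ∧ 0 < m x := by
  have hnorm : ‖W.mkQ x‖ ≠ 0 := by simpa
  obtain ⟨g, -, hg⟩ := exists_dual_vector ℝ (W.mkQ x) hnorm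
  refine ⟨g.comp W.mkQL, fun y hy => ?_, ?_⟩
  · have hy0 : W.mkQ y = 0 := by simpa
    exact (congrArg g hy0).trans (map_zero g)
  · exact (lt_of_le_of_ne (norm_nonneg _) hnorm.symm).trans_eq hg.symm

theorem exists_strongDual_eq_and_lt_of_dim_lt {S F : Set E} {g : E} (hSF : S ⊆ F) (hg : g ∈ S)
    (hdim : dim S < dim F) :
    ∃ m : StrongDual ℝ E, (∀ x ∈ S, m x = m g) ∧ ∃ w ∈ F, m g < m w := by
  have : FiniteDimensional ℝ (vectorSpan ℝ F) := .of_finrank_pos (Nat.zero_lt_of_lt hdim)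
  have : FiniteDimensional ℝ (vectorSpan ℝ S) :=
    Submodule.finiteDimensional_of_le (vectorSpan_mono ℝ hSF)
  obtain ⟨w, hw, hwS⟩ : ∃ w ∈ F, w -ᵥ g ∉ vectorSpan ℝ S := by
    by_contra! h
    refine hdim.not_ge (Submodule.finrank_mono ?_)
    rw [vectorSpan_eq_span_vsub_set_right ℝ (hSF hg)]
    exact Submodule.span_le.2 (Set.image_subset_iff.2 h)
  have : IsClosed (vectorSpan ℝ S : Set E) := Submodule.closed_of_finiteDimensional _
  obtain ⟨m, hm, hmw⟩ := exists_strongDual_le_ker_and_pos _ hwS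
  refine ⟨m, fun x hx => ?_, w, hw, ?_⟩
  · rw [← sub_eq_zero, ← map_sub]
    exact hm (vsub_mem_vectorSpan ℝ hx hg)
  · rwa [vsub_eq_sub, map_sub, sub_pos] at hmw

namespace IsVPolytope

variable {F G : Set E} {v : E}

/-- A hyperplane supporting `F` along `G` is tilted around the affine span of `G` and `v` until it
meets a further vertex of `F`. -/
theorem exists_isExposed_ssuperset_notMem (hF : IsVPolytope F) (hG : IsExposed ℝ F G)
    (hne : G.Nonempty) (hv : v ∈ F) (hvG : v ∉ G) (hdim : dim G + 1 < dim F) :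
    ∃ H, IsExposed ℝ F H ∧ G ⊂ H ∧ v ∉ H := by
  obtain ⟨l, M, hl, rfl⟩ := exists_eq_setOf_of_isExposed hG hne
  set G := {x ∈ F | l x = M}
  obtain ⟨g, hg⟩ := hne
  obtain ⟨m, hm, w, hw, hmw⟩ := exists_strongDual_eq_and_lt_of_dim_lt
    (Set.insert_subset hv hG.subset) (Set.mem_insert_of_mem v hg)
    ((finrank_vectorSpan_insert_le_set ℝ G v).trans_lt hdim)
  have hlt : ∀ x ∈ F, x ∉ G → l x < M := fun x hx hxG =>
    (hl x hx).lt_of_ne fun h => hxG ⟨hx, h⟩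
  obtain ⟨ε, -, hle, z, hz, hmz, hzeq⟩ := exists_pos_forall_add_mul_nonpos_and_eq_zero
    hF.finite_vert (fun x => l x - M) (fun x => m x - m g)
    (fun x hx => sub_nonpos.2 (hl x (vert_subset F hx)))
    (fun x hx hmx => sub_neg.2 (hlt x (vert_subset F hx) fun hxG =>
      (sub_pos.1 hmx).ne' (hm x (Set.mem_insert_of_mem v hxG))))
    (by
      by_contra! h
      exact hmw.not_ge (hF.le_of_forall_vert (fun x hx => sub_nonpos.1 (h x hx)) w hw))
  have tilt_eq : ∀ x, (l + ε • m) x - (M + ε * m g) = l x - M + ε * (m x - m g) := fun x => by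
    rw [add_apply, smul_apply, smul_eq_mul]
    ring
  have tilt_eq_of_mem : ∀ x ∈ insert v G, (l + ε • m) x - (M + ε * m g) = l x - M :=
    fun x hx => by rw [tilt_eq, hm x hx, sub_self, mul_zero, add_zero]
  have hGH : G ⊆ {x ∈ F | (l + ε • m) x = M + ε * m g} := fun x hx => ⟨hx.1, by
    rw [← sub_eq_zero, tilt_eq_of_mem x (Set.mem_insert_of_mem v hx), hx.2, sub_self]⟩
  refine ⟨_, isExposed_setOf_eq (hF.le_of_forall_vert fun x hx =>
    sub_nonpos.1 ((tilt_eq x).trans_le (hle x hx))), (Set.ssubset_iff_of_subset hGH).2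
    ⟨z, ⟨vert_subset F hz, sub_eq_zero.1 ((tilt_eq z).trans hzeq)⟩, fun hzG =>
      (sub_pos.1 hmz).ne' (hm z (Set.mem_insert_of_mem v hzG))⟩, fun h => ?_⟩
  refine (hlt v hv hvG).ne (sub_eq_zero.1 ?_)
  rw [← tilt_eq_of_mem v (Set.mem_insert v G), h.2, sub_self]

theorem exists_isExposed_superset_notMem_dim_add_one (hF : IsVPolytope F) (hG : IsExposed ℝ F G)
    (hne : G.Nonempty) (hv : v ∈ F) (hvG : v ∉ G) :
    ∃ H, IsExposed ℝ F H ∧ G ⊆ H ∧ v ∉ H ∧ dim H + 1 = dim F := by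
  have := hF.finiteDimensional_vectorSpan
  induction hn : dim F - dim G using Nat.strong_induction_on generalizing G with
  | _ n ih =>
    subst hn
    have dim_G_lt := dim_lt_of_isExposed hG hne (ne_of_mem_of_not_mem' hv hvG).symm
    rcases (Nat.succ_le_of_lt dim_G_lt).eq_or_lt with hdim | hdim
    · exact ⟨G, hG, subset_rfl, hvG, hdim⟩
    obtain ⟨H, hH, hGH, hvH⟩ := hF.exists_isExposed_ssuperset_notMem hG hne hv hvG hdim
    have := (hF.isExposed hH).finiteDimensional_vectorSpan
    have dim_G_lt_dim_H := dim_lt_of_isExposed (hG.mono hH.subset hGH.subset) hne hGH.ne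
    obtain ⟨K, hK, hHK, hvK, hdimK⟩ :=
      ih (dim F - dim H) (by omega) hH (hne.mono hGH.subset) hvH rfl
    exact ⟨K, hK, hGH.subset.trans hHK, hvK, hdimK⟩

end IsVPolytope

/-! ### Pulling simplices -/

theorem InGeneralPosition.eq {P : Set E} {c : StrongDual ℝ E} (hc : InGeneralPosition P c)
    {v w : E} (hv : v ∈ vert P) (hw : w ∈ vert P) (h : c v = c w) : v = w := by
  by_contra hvw
  exact hc v hv w hw hvw h

theorem IsVPolytope.exists_isMinOn_of_isExposed {P F : Set E} (hP : IsVPolytope P)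
    (hF : IsExposed ℝ P F) (hne : F.Nonempty) (c : StrongDual ℝ E) :
    ∃ v ∈ vert P, v ∈ F ∧ IsMinOn c F v := by
  obtain ⟨v, hv, hmin⟩ := (hP.isExposed hF).exists_isMinOn_vert hne c
  rw [hP.vert_face hF] at hv
  exact ⟨v, hv.1, hv.2, hmin⟩

/-- The simplices of the triangulation of `P` obtained by pulling the vertices in increasing order
of `c`: each vertex `x` of the simplex minimizes `c` on a face of `P` that contains the vertices of
the simplex at which `c` is at least `c x`. The empty set counts as a pulling simplex. -/
def IsPullingSimplex (P : Set E) (c : StrongDual ℝ E) (s : Finset E) : Prop :=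
  (s : Set E) ⊆ vert P ∧
    ∀ x ∈ s, ∃ F, IsExposed ℝ P F ∧ IsMinOn c F x ∧ ∀ y ∈ s, c x ≤ c y → y ∈ F

namespace IsPullingSimplex

variable {P F : Set E} {c : StrongDual ℝ E} {s t : Finset E} {v : E}

theorem mono (hs : IsPullingSimplex P c s) (hts : t ⊆ s) : IsPullingSimplex P c t :=
  ⟨(Finset.coe_subset.2 hts).trans hs.1, fun x hx =>
    let ⟨F, hF, hmin, hsF⟩ := hs.2 x (hts hx)
    ⟨F, hF, hmin, fun y hy => hsF y (hts hy)⟩⟩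

theorem exists_isMinOn_face (hs : IsPullingSimplex P c s) (hne : s.Nonempty) :
    ∃ x ∈ s, ∃ F, IsExposed ℝ P F ∧ IsMinOn c F x ∧ (s : Set E) ⊆ F := by
  obtain ⟨x, hx, hxs⟩ := s.exists_min_image c hne
  obtain ⟨F, hF, hmin, hsF⟩ := hs.2 x hx
  exact ⟨x, hx, F, hF, hmin, fun y hy => hsF y hy (hxs y hy)⟩

theorem singleton (hv : v ∈ vert P) : IsPullingSimplex P c {v} := by
  refine ⟨by simpa using hv, fun x hx => ⟨{v}, mem_exposedPoints_iff_exposed_singleton.1 hv, ?_,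
    fun y hy _ => Finset.mem_singleton.1 hy⟩⟩
  rw [Finset.mem_singleton.1 hx]
  exact isMinOn_iff.2 (by simp)

theorem lt_of_isMinOn_of_notMem (hs : IsPullingSimplex P c s) (hc : InGeneralPosition P c)
    (hv : v ∈ vert P) (hmin : IsMinOn c F v) (hsF : (s : Set E) ⊆ F) (hvs : v ∉ s) {x : E}
    (hx : x ∈ s) : c v < c x :=
  (hmin (hsF hx)).lt_of_ne fun h => hvs (hc.eq hv (hs.1 hx) h ▸ hx)

theorem insert_of_isMinOn [DecidableEq E] (hs : IsPullingSimplex P c s) (hc : InGeneralPosition P c)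
    (hF : IsExposed ℝ P F) (hv : v ∈ vert P) (hvF : v ∈ F) (hmin : IsMinOn c F v)
    (hsF : (s : Set E) ⊆ F) : IsPullingSimplex P c (insert v s) := by
  by_cases hvs : v ∈ s
  · rwa [Finset.insert_eq_of_mem hvs]
  refine ⟨?_, Finset.forall_mem_insert _ _ _ |>.2 ⟨⟨F, hF, hmin, ?_⟩, fun x hx => ?_⟩⟩
  · rw [Finset.coe_insert]
    exact Set.insert_subset hv hs.1
  · exact Finset.forall_mem_insert _ _ _ |>.2 ⟨fun _ => hvF, fun y hy _ => hsF hy⟩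
  · obtain ⟨G, hG, hminG, hsG⟩ := hs.2 x hx
    have hvx := hs.lt_of_isMinOn_of_notMem hc hv hmin hsF hvs hx
    exact ⟨G, hG, hminG, Finset.forall_mem_insert _ _ _ |>.2 ⟨fun h => absurd hvx h.not_gt, hsG⟩⟩

theorem exists_isExposed_notMem (hs : IsPullingSimplex P c s) (hc : InGeneralPosition P c)
    (hF : IsExposed ℝ P F) (hv : v ∈ vert P) (hmin : IsMinOn c F v) (hsF : (s : Set E) ⊆ F)
    (hvs : v ∉ s) (hne : s.Nonempty) : ∃ G, IsExposed ℝ F G ∧ v ∉ G ∧ (s : Set E) ⊆ G := by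
  obtain ⟨x, hx, G, hG, hminG, hsG⟩ := hs.exists_isMinOn_face hne
  exact ⟨F ∩ G, (hF.inter hG).mono hF.subset Set.inter_subset_left,
    fun h => (hs.lt_of_isMinOn_of_notMem hc hv hmin hsF hvs hx).not_ge (hminG h.2),
    Set.subset_inter hsF hsG⟩

/-! ### Uniqueness of representations -/

/-- The lowest vertices of the two supports coincide: each minimizes `c` on a face of `P` which
contains both supports. -/
theorem exists_mem_support_and_mem_support {a b : E →₀ ℝ≥0} (ha : IsPullingSimplex P c a.support)
    (hb : IsPullingSimplex P c b.support) (hc : InGeneralPosition P c)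
    (hab : conicCombination E a = conicCombination E b) (ha0 : a ≠ 0) :
    ∃ v ∈ a.support, v ∈ b.support := by
  have hb0 : b ≠ 0 := by
    rintro rfl
    exact ha0 (eq_zero_of_conicCombination_eq_zero (hab.trans (map_zero _)))
  obtain ⟨v, hva, F, hF, hminF, haF⟩ := ha.exists_isMinOn_face (Finsupp.support_nonempty_iff.2 ha0)
  obtain ⟨w, hwb, G, hG, hminG, hbG⟩ := hb.exists_isMinOn_face (Finsupp.support_nonempty_iff.2 hb0)
  have hvG := support_subset_of_isExposed hG (ha.1.trans (vert_subset P)) hbG hab hva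
  have hwF := support_subset_of_isExposed hF (hb.1.trans (vert_subset P)) haF hab.symm hwb
  obtain rfl := hc.eq (ha.1 hva) (hb.1 hwb) ((hminF hwF).antisymm (hminG hvG))
  exact ⟨v, hva, hwb⟩

theorem eq_of_conicCombination_eq {a b : E →₀ ℝ≥0} (ha : IsPullingSimplex P c a.support)
    (hb : IsPullingSimplex P c b.support) (hc : InGeneralPosition P c)
    (hab : conicCombination E a = conicCombination E b) : a = b := by
  induction hn : a.support.card + b.support.card using Nat.strong_induction_on
    generalizing a b with
  | _ n ih =>
    rcases eq_or_ne a 0 with rfl | ha0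
    · exact (eq_zero_of_conicCombination_eq_zero (hab.symm.trans (map_zero _))).symm
    obtain ⟨v, hva, hvb⟩ := ha.exists_mem_support_and_mem_support hb hc hab ha0
    wlog hle : a v ≤ b v generalizing a b
    · exact (this hb ha hab.symm ((add_comm _ _).trans hn)
        (Finsupp.support_nonempty_iff.1 ⟨v, hvb⟩) hvb hva (le_of_not_ge hle)).symm
    have hda : Finsupp.single v (a v) ≤ a := Finsupp.single_le_iff.2 le_rfl
    have hdb : Finsupp.single v (a v) ≤ b := Finsupp.single_le_iff.2 hle
    have hcard : (a - Finsupp.single v (a v)).support.card < a.support.card :=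
      Finset.card_lt_card ((Finset.ssubset_iff_of_subset Finsupp.support_tsub).2
        ⟨v, hva, by simp⟩)
    have hcard' : (b - Finsupp.single v (a v)).support.card ≤ b.support.card :=
      Finset.card_le_card Finsupp.support_tsub
    rw [← tsub_add_cancel_of_le hda, ← tsub_add_cancel_of_le hdb, map_add, map_add,
      add_left_inj] at hab
    have hsub := ih _ (by omega) (ha.mono Finsupp.support_tsub) (hb.mono Finsupp.support_tsub)
      hab rfl
    rw [← tsub_add_cancel_of_le hda, hsub, tsub_add_cancel_of_le hdb]

theorem convexHull_inter_convexHull_subset (hs : IsPullingSimplex P c s)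
    (ht : IsPullingSimplex P c t) (hc : InGeneralPosition P c) {A B : Set E} (hA : A ⊆ s)
    (hB : B ⊆ t) : convexHull ℝ A ∩ convexHull ℝ B ⊆ convexHull ℝ (A ∩ B) := by
  rintro p ⟨hpA, hpB⟩
  obtain ⟨a, haA, hap⟩ := mem_convexHull_iff_exists_conicCombination.1 hpA
  obtain ⟨b, hbB, hbp⟩ := mem_convexHull_iff_exists_conicCombination.1 hpB
  obtain rfl := (hs.mono (Finset.coe_subset.1 (haA.trans hA))).eq_of_conicCombination_eq
    (ht.mono (Finset.coe_subset.1 (hbB.trans hB))) hc (hap.trans hbp.symm)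
  exact mem_convexHull_iff_exists_conicCombination.2 ⟨a, Set.subset_inter haA hbB, hap⟩

theorem affineIndependent (hs : IsPullingSimplex P c s) (hc : InGeneralPosition P c) :
    AffineIndependent ℝ ((↑) : s → E) := by
  by_contra h
  obtain ⟨I, hI⟩ := Convex.radon_partition h
  have hsubset : ∀ J : Set s, ((↑) : s → E) '' J ⊆ s := fun J => by
    rintro _ ⟨x, -, rfl⟩
    exact x.2
  have hinter := hs.convexHull_inter_convexHull_subset hs hc (hsubset I) (hsubset Iᶜ)
  refine (hI.mono hinter).ne_empty ?_
  rw [← Set.image_inter Subtype.val_injective, Set.inter_compl_self, Set.image_empty,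
    convexHull_empty]

theorem card_le (hs : IsPullingSimplex P c s) (hc : InGeneralPosition P c)
    [FiniteDimensional ℝ (vectorSpan ℝ F)] (hsF : (s : Set E) ⊆ F) : s.card ≤ dim F + 1 := by
  have hcard := (hs.affineIndependent hc).card_le_finrank_succ
  rw [Fintype.card_coe] at hcard
  exact hcard.trans (Nat.succ_le_succ (Submodule.finrank_mono
    (vectorSpan_mono ℝ (Subtype.range_coe.trans_subset hsF))))

end IsPullingSimplex

namespace IsVPolytope

variable {P F : Set E} {c : StrongDual ℝ E} {s : Finset E} {v p : E}

theorem exists_isPullingSimplex_mem_convexHull (hP : IsVPolytope P) (hc : InGeneralPosition P c)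
    (hF : IsExposed ℝ P F) (hp : p ∈ F) :
    ∃ s, IsPullingSimplex P c s ∧ (s : Set E) ⊆ F ∧ p ∈ convexHull ℝ (s : Set E) := by
  classical
  induction hn : (vert F).ncard using Nat.strong_induction_on generalizing F p with
  | _ n ih =>
    subst hn
    have hFV := hP.isExposed hF
    obtain ⟨v, hv, hvF, hmin⟩ := hP.exists_isMinOn_of_isExposed hF ⟨p, hp⟩ c
    rcases eq_or_ne p v with rfl | hpv
    · exact ⟨{p}, .singleton hv, by simpa using hvF, by simp⟩
    obtain ⟨G, hG, hvG, q, hq, hpq⟩ := hFV.exists_isExposed_notMem_and_mem_segment hp hpv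
    obtain ⟨s, hs, hsG, hqs⟩ := ih _ (hFV.ncard_vert_lt hG (ne_of_mem_of_not_mem' hvF hvG).symm)
      (hP.isExposed_trans hF hG) hq rfl
    have hsF := hsG.trans hG.subset
    refine ⟨insert v s, hs.insert_of_isMinOn hc hF hv hvF hmin hsF, ?_, ?_⟩
    · rw [Finset.coe_insert]
      exact Set.insert_subset hvF hsF
    · rw [Finset.coe_insert]
      exact (convex_convexHull ℝ _).segment_subset (subset_convexHull ℝ _ (Set.mem_insert v s))
        (convexHull_mono (Set.subset_insert v s) hqs) hpq

theorem mem_of_isPullingSimplex_of_card_eq (hP : IsVPolytope P) (hc : InGeneralPosition P c)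
    (hF : IsExposed ℝ P F) (hv : v ∈ vert P) (hvF : v ∈ F) (hmin : IsMinOn c F v)
    (hs : IsPullingSimplex P c s) (hsF : (s : Set E) ⊆ F) (hcard : s.card = dim F + 1) :
    v ∈ s := by
  by_contra hvs
  have hne : s.Nonempty := Finset.card_pos.1 (by omega)
  obtain ⟨G, hG, hvG, hsG⟩ := hs.exists_isExposed_notMem hc hF hv hmin hsF hvs hne
  have := (hP.isExposed hF).finiteDimensional_vectorSpan
  have := ((hP.isExposed hF).isExposed hG).finiteDimensional_vectorSpan
  have hcard_le := hs.card_le hc hsG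
  have hdim_lt := dim_lt_of_isExposed hG (hne.to_set.mono hsG)
    (ne_of_mem_of_not_mem' hvF hvG).symm
  omega

theorem exists_isExposed_notMem_of_isPullingSimplex (hP : IsVPolytope P)
    (hc : InGeneralPosition P c) (hF : IsExposed ℝ P F) (hnt : F.Nontrivial) (hv : v ∈ vert P)
    (hmin : IsMinOn c F v) (hs : IsPullingSimplex P c s) (hsF : (s : Set E) ⊆ F) (hvs : v ∉ s) :
    ∃ G, IsExposed ℝ F G ∧ G.Nonempty ∧ v ∉ G ∧ (s : Set E) ⊆ G := by
  rcases s.eq_empty_or_nonempty with rfl | hne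
  · obtain ⟨p, hp, hpv⟩ := hnt.exists_ne v
    obtain ⟨G, hG, hvG, q, hq, -⟩ :=
      (hP.isExposed hF).exists_isExposed_notMem_and_mem_segment hp hpv
    exact ⟨G, hG, ⟨q, hq⟩, hvG, by simp⟩
  · obtain ⟨G, hG, hvG, hsG⟩ := hs.exists_isExposed_notMem hc hF hv hmin hsF hvs hne
    exact ⟨G, hG, hne.to_set.mono hsG, hvG, hsG⟩

theorem exists_isPullingSimplex_superset_card_eq (hP : IsVPolytope P) (hc : InGeneralPosition P c)
    (hF : IsExposed ℝ P F) (hne : F.Nonempty) (hs : IsPullingSimplex P c s)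
    (hsF : (s : Set E) ⊆ F) :
    ∃ t, IsPullingSimplex P c t ∧ (t : Set E) ⊆ F ∧ s ⊆ t ∧ t.card = dim F + 1 := by
  classical
  induction hn : (vert F).ncard using Nat.strong_induction_on generalizing F s with
  | _ n ih =>
    subst hn
    have hFV := hP.isExposed hF
    obtain ⟨v, hv, hvF, hmin⟩ := hP.exists_isMinOn_of_isExposed hF hne c
    rcases Set.eq_singleton_or_nontrivial hvF with rfl | hnt
    · refine ⟨{v}, .singleton hv, by simp, by simpa [← Finset.coe_subset] using hsF, ?_⟩
      rw [dim, vectorSpan_singleton, finrank_bot, Finset.card_singleton]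
    have hs' := hs.mono (s.erase_subset v)
    have hsF' := (Finset.coe_subset.2 (s.erase_subset v)).trans hsF
    obtain ⟨G, hG, hGne, hvG, hsG⟩ := hP.exists_isExposed_notMem_of_isPullingSimplex hc hF hnt hv
      hmin hs' hsF' (s.notMem_erase v)
    obtain ⟨H, hH, hGH, hvH, hdim⟩ :=
      hFV.exists_isExposed_superset_notMem_dim_add_one hG hGne hvF hvG
    obtain ⟨t, ht, htH, hst, hcard⟩ := ih _
      (hFV.ncard_vert_lt hH (ne_of_mem_of_not_mem' hvF hvH).symm) (hP.isExposed_trans hF hH)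
      (hGne.mono hGH) hs' (hsG.trans hGH) rfl
    have htF := htH.trans hH.subset
    refine ⟨insert v t, ht.insert_of_isMinOn hc hF hv hvF hmin htF, ?_,
      Finset.subset_insert_iff.2 hst, ?_⟩
    · rw [Finset.coe_insert]
      exact Set.insert_subset hvF htF
    · rw [Finset.card_insert_of_notMem fun h => hvH (htH h), hcard, hdim]

end IsVPolytope

/-! ### Sinks and general position -/

namespace IsVPolytope

variable {P F : Set E} {c : StrongDual ℝ E} {v : E}

theorem isSink_iff (hP : IsVPolytope P) (hF : IsExposed ℝ P F) :
    IsSink P c F v ↔ v ∈ vert F ∧ IsMinOn c F v := by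
  refine and_congr_right fun hv => ⟨fun hsink => ?_, fun hmin w hw hvw => ?_⟩
  · by_contra hmin
    obtain ⟨w, hw, hlt, hexp⟩ := (hP.isExposed hF).exists_isExposed_segment_lt hv hmin
    have hvert := hP.vert_face hF
    exact hsink w hw ⟨⟨fun h => hlt.ne (congrArg c h.symm), (hvert ▸ hv).1, (hvert ▸ hw).1,
      hP.isExposed_trans hF hexp⟩, hlt⟩
  · exact (hmin (vert_subset F hw)).not_gt hvw.2

theorem existsUnique_isSink (hP : IsVPolytope P) (hc : InGeneralPosition P c)
    (hF : IsNonemptyFace P F) : ∃! v, IsSink P c F v := by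
  simp only [hP.isSink_iff hF.1, hP.vert_face hF.1]
  obtain ⟨v, hv, hvF, hmin⟩ := hP.exists_isMinOn_of_isExposed hF.1 hF.2 c
  exact ⟨v, ⟨⟨hv, hvF⟩, hmin⟩, fun w ⟨⟨hw, hwF⟩, hminw⟩ =>
    hc.eq hw hv ((hminw hvF).antisymm (hmin hwF))⟩

theorem exists_inGeneralPosition (hP : IsVPolytope P) :
    ∃ c : StrongDual ℝ E, InGeneralPosition P c := by
  have := hP.finite_vert.offDiag.to_subtype
  let ev : (vert P).offDiag → Module.Dual ℝ (StrongDual ℝ E) := fun p =>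
    (topDualPairing ℝ E).flip (p.1.1 - p.1.2)
  obtain ⟨c, hc⟩ := Module.Dual.exists_forall_ne_zero_of_forall_exists ev fun p =>
    SeparatingDual.exists_ne_zero (sub_ne_zero.2 p.2.2.2)
  refine ⟨c, fun v hv w hw hvw h => hc ⟨(v, w), hv, hw, hvw⟩ ?_⟩
  exact (map_sub c v w).trans (sub_eq_zero.2 h)

end IsVPolytope

/-! ### H-polytopes -/

/-- Otherwise `x` could be moved a little away from `y` along the line through both. -/
theorem eq_of_mem_extremePoints_of_forall_eq {ι : Type*} [Finite ι] {a : ι → StrongDual ℝ E}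
    {z : ι → ℝ} {x y : E} (hx : x ∈ {x | ∀ i, a i x ≤ z i}.extremePoints ℝ)
    (hy : ∀ i, a i y ≤ z i) (hxy : ∀ i, a i x = z i → a i y = z i) : x = y := by
  obtain ⟨ε, hε, hlt⟩ := exists_pos_forall_add_mul_neg (Set.toFinite {i | a i x < z i})
    (fun i => a i x - z i) (fun i => a i (x - y)) fun i hi => sub_neg.2 hi
  have hmem : x + ε • (x - y) ∈ {x | ∀ i, a i x ≤ z i} := fun i => by
    rw [map_add, map_smul, smul_eq_mul]
    rcases (hx.1 i).lt_or_eq with h | h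
    · linarith [hlt i h]
    · rw [map_sub, h, hxy i h, sub_self, mul_zero, add_zero]
  refine (hx.2 hy hmem ⟨ε / (1 + ε), 1 / (1 + ε), by positivity, by positivity, ?_, ?_⟩).symm
  · field_simp
    ring
  · match_scalars <;> field_simp
    ring

namespace IsHPolytope

variable {P : Set E}

theorem isClosed (hP : IsHPolytope P) : IsClosed P := by
  obtain ⟨-, m, a, z, rfl⟩ := hP
  rw [Set.ofPred_forall]
  exact isClosed_iInter fun i => isClosed_le (a i).continuous continuous_const

theorem convex (hP : IsHPolytope P) : Convex ℝ P := by
  obtain ⟨-, m, a, z, rfl⟩ := hP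
  rw [Set.ofPred_forall]
  exact convex_iInter fun i => convex_halfSpace_le (a i).isLinear (z i)

/-- A line on which all the functionals are constant would stay in `P`. -/
theorem finiteDimensional (hP : IsHPolytope P) (hne : P.Nonempty) : FiniteDimensional ℝ E := by
  obtain ⟨hbdd, m, a, z, rfl⟩ := hP
  obtain ⟨p, hp⟩ := hne
  let A : E →ₗ[ℝ] Fin m → ℝ := LinearMap.pi fun i => (a i).toLinearMap
  refine Module.Finite.of_injective A ((injective_iff_map_eq_zero A).2 fun x hx => ?_)
  by_contra hx0
  have hline : ∀ t : ℝ, p + t • x ∈ {x | ∀ i, a i x ≤ z i} := fun t i => by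
    have hxi : a i x = 0 := congrFun hx i
    simpa [hxi] using hp i
  obtain ⟨C, hC⟩ := hbdd.exists_norm_le
  have hnorm : ‖((‖p‖ + |C| + 1) / ‖x‖) • x‖ = ‖p‖ + |C| + 1 := by
    rw [norm_smul, Real.norm_of_nonneg (by positivity), div_mul_cancel₀ _ (norm_ne_zero_iff.2 hx0)]
  have hle := norm_le_add_norm_add (((‖p‖ + |C| + 1) / ‖x‖) • x) p
  rw [add_comm _ p] at hle
  linarith [hC _ (hline ((‖p‖ + |C| + 1) / ‖x‖)), le_abs_self C]

theorem finite_extremePoints (hP : IsHPolytope P) : (P.extremePoints ℝ).Finite := by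
  obtain ⟨-, m, a, z, rfl⟩ := hP
  refine Set.Finite.of_finite_image (f := fun x => {i | a i x = z i}) (Set.toFinite _)
    fun x hx y hy hxy => ?_
  exact eq_of_mem_extremePoints_of_forall_eq hx hy.1 fun i hi => (Set.ext_iff.1 hxy i).1 hi

theorem isVPolytope (hP : IsHPolytope P) : IsVPolytope P := by
  rcases P.eq_empty_or_nonempty with rfl | hne
  · exact ⟨∅, by simp⟩
  have := hP.finiteDimensional hne
  have := FiniteDimensional.proper_real E
  have hcompact := Metric.isCompact_of_isClosed_isBounded hP.isClosed hP.1
  refine ⟨hP.finite_extremePoints.toFinset, ?_⟩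
  rw [Set.Finite.coe_toFinset,
    ← (hP.finite_extremePoints.isClosed_convexHull ℝ).closure_eq,
    closure_convexHull_extremePoints hcompact hP.convex]

end IsHPolytope

theorem IsPolytope.isVPolytope {P : Set E} (hP : IsPolytope P) : IsVPolytope P :=
  hP.elim id IsHPolytope.isVPolytope

/-! ### The pulling triangulation -/

/-- The simplicial complex of the nonempty pulling simplices of `P` with respect to `c`. It is the
pointed triangulation whose apexes are the minimizers of `c` on the faces of `P`. -/
def pullingComplex (P : Set E) (c : StrongDual ℝ E) (hc : InGeneralPosition P c) :
    SimplicialComplex ℝ E where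
  faces := {s | s.Nonempty ∧ IsPullingSimplex P c s}
  isRelLowerSet_faces := fun _ hs => ⟨hs.1, fun _ hts ht => ⟨ht, hs.2.mono hts⟩⟩
  indep := fun hs => hs.2.affineIndependent hc
  inter_subset_convexHull := fun hs ht =>
    hs.2.convexHull_inter_convexHull_subset ht.2 hc subset_rfl subset_rfl

namespace IsVPolytope

variable {P F : Set E} {c : StrongDual ℝ E} {s : Finset E} {v w : E}

theorem finite_faces_pullingComplex (hP : IsVPolytope P) (hc : InGeneralPosition P c) :
    (pullingComplex P c hc).faces.Finite :=
  (hP.finite_vert.powerset.preimage Finset.coe_injective.injOn).subset fun _ hs => hs.2.1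

theorem mem_restrict_pullingComplex (hP : IsVPolytope P) (hc : InGeneralPosition P c)
    (hF : IsExposed ℝ P F) : s ∈ (restrict (pullingComplex P c hc) F).faces ↔
      s.Nonempty ∧ IsPullingSimplex P c s ∧ (s : Set E) ⊆ F := by
  rw [← and_assoc]
  exact and_congr_right fun _ => (hF.convex hP.convex).convexHull_subset_iff

theorem isTriangulation_restrict_pullingComplex (hP : IsVPolytope P) (hc : InGeneralPosition P c)
    (hF : IsExposed ℝ P F) : IsTriangulation F (restrict (pullingComplex P c hc) F) := by
  refine ⟨(hP.finite_faces_pullingComplex hc).subset fun s hs => hs.1, Set.ext fun p => ?_⟩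
  rw [SimplicialComplex.mem_space_iff]
  refine ⟨fun ⟨s, hs, hps⟩ => hs.2 hps, fun hp => ?_⟩
  obtain ⟨s, hs, hsF, hps⟩ := hP.exists_isPullingSimplex_mem_convexHull hc hF hp
  have hne := Finset.coe_nonempty.1 (convexHull_nonempty_iff.1 ⟨p, hps⟩)
  exact ⟨s, (hP.mem_restrict_pullingComplex hc hF).2 ⟨hne, hs, hsF⟩, hps⟩

theorem restrict_pullingComplex_self (hP : IsVPolytope P) (hc : InGeneralPosition P c) :
    restrict (pullingComplex P c hc) P = pullingComplex P c hc :=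
  SimplicialComplex.ext <| Set.ext fun _ =>
    and_iff_left_of_imp fun hs => convexHull_min (hs.2.1.trans (vert_subset P)) hP.convex

theorem exists_superset_mem_restrict_pullingComplex (hP : IsVPolytope P)
    (hc : InGeneralPosition P c) (hF : IsNonemptyFace P F)
    (hs : s ∈ (restrict (pullingComplex P c hc) F).faces) :
    ∃ t ∈ (restrict (pullingComplex P c hc) F).faces, s ⊆ t ∧ t.card = dim F + 1 := by
  obtain ⟨hne, hs, hsF⟩ := (hP.mem_restrict_pullingComplex hc hF.1).1 hs
  obtain ⟨t, ht, htF, hst, hcard⟩ :=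
    hP.exists_isPullingSimplex_superset_card_eq hc hF.1 hF.2 hs hsF
  exact ⟨t, (hP.mem_restrict_pullingComplex hc hF.1).2 ⟨hne.mono hst, ht, htF⟩, hst, hcard⟩

theorem pair_mem_restrict_pullingComplex [DecidableEq E] (hP : IsVPolytope P)
    (hc : InGeneralPosition P c) (hF : IsExposed ℝ P F) (hv : v ∈ vert P) (hvF : v ∈ F)
    (hmin : IsMinOn c F v) (hw : w ∈ vert P) (hwF : w ∈ F) :
    {v, w} ∈ (restrict (pullingComplex P c hc) F).faces := by
  refine (hP.mem_restrict_pullingComplex hc hF).2 ⟨Finset.insert_nonempty v {w}, ?_, ?_⟩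
  · exact (IsPullingSimplex.singleton hw).insert_of_isMinOn hc hF hv hvF hmin (by simpa using hwF)
  · simpa using Set.pair_subset hvF hwF

theorem isPointedTriangulation_pullingComplex (hP : IsVPolytope P) (hc : InGeneralPosition P c)
    {apex : Set E → E} (hapex : ∀ F, IsNonemptyFace P F → IsSink P c F (apex F)) :
    IsPointedTriangulation P (pullingComplex P c hc) apex := by
  classical
  have hvert F (hF : IsNonemptyFace P F) : apex F ∈ vert P ∧ apex F ∈ F :=
    (hP.vert_face hF.1).subset (hapex F hF).1
  have hmin F (hF : IsNonemptyFace P F) : IsMinOn c F (apex F) :=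
    ((hP.isSink_iff hF.1).1 (hapex F hF)).2
  refine
    { triangulation := ?_
      face_triangulation := fun F hF => hP.isTriangulation_restrict_pullingComplex hc hF.1
      face_pure := fun F hF s hs => hP.exists_superset_mem_restrict_pullingComplex hc hF hs
      apex_mem_vert := fun F hF => (hapex F hF).1
      apex_mem_simplex := fun F hF t ht hcard => ?_
      apex_compatible := fun F₁ F₂ hF₁ hF₂ h₁ h₂ =>
        hc.eq (hvert F₁ hF₁).1 (hvert F₂ hF₂).1 ((hmin F₁ hF₁ h₂.1).antisymm (hmin F₂ hF₂ h₁.2))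
      apex_edge := fun F hF w hw _ => ⟨{apex F, w}, ?_, Finset.coe_pair⟩ }
  · rw [← hP.restrict_pullingComplex_self hc]
    exact hP.isTriangulation_restrict_pullingComplex hc (IsExposed.refl P)
  · obtain ⟨-, ht, htF⟩ := (hP.mem_restrict_pullingComplex hc hF.1).1 ht
    exact subset_convexHull ℝ _ (hP.mem_of_isPullingSimplex_of_card_eq hc hF.1 (hvert F hF).1
      (hvert F hF).2 (hmin F hF) ht htF hcard)
  · rw [hP.vert_face hF.1] at hw
    exact hP.pair_mem_restrict_pullingComplex hc hF.1 (hvert F hF).1 (hvert F hF).2 (hmin F hF)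
      hw.1 hw.2

end IsVPolytope

theorem mainTheorem2_general (P : Set E) (hP : IsPolytope P) :
    (∃ c : StrongDual ℝ E, InGeneralPosition P c) ∧
    ∀ c : StrongDual ℝ E, InGeneralPosition P c →
      (∀ F, IsNonemptyFace P F → ∃! v, IsSink P c F v) ∧
      ∃ (K : SimplicialComplex ℝ E) (apex : Set E → E),
        IsPointedTriangulation P K apex ∧
        ∀ F, IsNonemptyFace P F → IsSink P c F (apex F) := by
  have hV := hP.isVPolytope
  refine ⟨hV.exists_inGeneralPosition, fun c hc => ?_⟩
  have hsink : ∀ F, IsNonemptyFace P F → ∃! v, IsSink P c F v := fun F hF =>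
    hV.existsUnique_isSink hc hF
  choose! apex hapex using fun F hF => (hsink F hF).exists
  exact ⟨hsink, pullingComplex P c hc, apex, hV.isPointedTriangulation_pullingComplex hc hapex,
    hapex⟩

end PointedTriangulation

theorem mainTheorem2 (n : ℕ) (P : Set (EuclideanSpace ℝ (Fin n)))
    (hP : PointedTriangulation.IsPolytope P) :
    (∃ c : StrongDual ℝ (EuclideanSpace ℝ (Fin n)),
      PointedTriangulation.InGeneralPosition P c) ∧
    ∀ c : StrongDual ℝ (EuclideanSpace ℝ (Fin n)),
      PointedTriangulation.InGeneralPosition P c →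
      (∀ F, PointedTriangulation.IsNonemptyFace P F →
        ∃! v, PointedTriangulation.IsSink P c F v) ∧
      ∃ (K : Geometry.SimplicialComplex ℝ (EuclideanSpace ℝ (Fin n)))
        (apex : Set (EuclideanSpace ℝ (Fin n)) → EuclideanSpace ℝ (Fin n)),
        PointedTriangulation.IsPointedTriangulation P K apex ∧
        ∀ F, PointedTriangulation.IsNonemptyFace P F →
          PointedTriangulation.IsSink P c F (apex F) :=
  PointedTriangulation.mainTheorem2_general P hP
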